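/- Let $G$ be a Polish group and let $H$ be a second countable, locally compact group. Let $\pi\colon G\to H$ be a universally measurable homomorphism, that is, a group homomorphism such that for every open set $U\subseteq H$ and every Borel probability measure $\mu$ on $G$, the set $\pi^{-1}(U)$ differs from some Borel subset of $G$ by a set of $\mu$-measure $0$. Then $\pi$ is continuous. -/

import Mathlib

open MeasureTheory

/-- A subset `A` of a measurable space (in use: a Polish space with its Borel σ-algebra) is
universally measurable if it is measurable with respect to every probability measure `μ`,
i.e. for every `μ` it differs from a measurable set by a `μ`-null set. -/
def UniversallyMeasurableSet {X : Type*} [MeasurableSpace X] (A : Set X) : Prop :=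
  ∀ μ : Measure X, IsProbabilityMeasure μ → NullMeasurableSet A μ

/-- A map into a topological space is universally measurable if the preimage of every open set
is universally measurable. -/
def UniversallyMeasurableMap {X Y : Type*} [MeasurableSpace X] [TopologicalSpace Y]
    (f : X → Y) : Prop :=
  ∀ U : Set Y, IsOpen U → UniversallyMeasurableSet (f ⁻¹' U)

/-! Suppose `π` is discontinuous. Then for some neighbourhood `C` of `1` and some `δ > 0`, elements
`g n` tending rapidly to `1` can be chosen successively so that, with `X` the random product of a
subset of the earlier terms, `π (X * g n * X⁻¹)` leaves `C` with probability at least `δ`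
(`exists_conjugateEscape`). The infinite products define a Borel map `φ` on the Cantor group, and
flipping bit `n` multiplies `φ` on the left by this conjugate or its inverse. But `π ∘ φ` is Haar
measurable, so flipping a late bit moves it little in probability (`tendsto_measure_div_notMem`), a
contradiction. -/

open Filter Topology Set
open scoped Pointwise ENNReal

/-! ### Cluster values at the identity and escape of conjugates -/

namespace MonoidHom

variable {G H : Type*} [Group G] [TopologicalSpace G] [IsTopologicalGroup G]
  [Group H] [TopologicalSpace H] [IsTopologicalGroup H]

/-- The subgroup of all cluster points of `π g` as `g` tends to `1`. -/
def clusterSubgroup (π : G →* H) : Subgroup H where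
  carrier := {h | MapClusterPt h (𝓝 1) π}
  one_mem' := by
    have : Tendsto π (pure 1) (𝓝 1) := by
      simpa using tendsto_pure_pure π 1 |>.mono_right (pure_le_nhds _)
    exact this.mapClusterPt.mono (pure_le_nhds 1)
  mul_mem' {a b} ha hb := by
    have h := (ha.prodMap hb).continuousAt_comp (f := fun p : H × H => p.1 * p.2)
      continuous_mul.continuousAt
    refine MapClusterPt.of_comp (φ := fun p : G × G => p.1 * p.2) (p := 𝓝 1 ×ˢ 𝓝 1) ?_ ?_
    · simpa [nhds_prod_eq] using (continuous_mul (M := G)).tendsto (1, 1)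
    · convert h using 1
      ext p
      simp
  inv_mem' {a} ha := by
    have h := MapClusterPt.continuousAt_comp (f := fun p : H => p⁻¹)
      continuous_inv.continuousAt ha
    refine MapClusterPt.of_comp (φ := fun p : G => p⁻¹) (p := 𝓝 1) ?_ ?_
    · simpa using (continuous_inv (G := G)).tendsto 1
    · convert h using 1
      ext p
      simp

variable (π : G →* H)

theorem mem_clusterSubgroup {h : H} : h ∈ π.clusterSubgroup ↔ MapClusterPt h (𝓝 1) π := Iff.rfl

theorem isClosed_clusterSubgroup : IsClosed (π.clusterSubgroup : Set H) :=
  isClosed_setOfPred_clusterPt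

theorem conj_mem_clusterSubgroup (y : G) {h : H} (hh : h ∈ π.clusterSubgroup) :
    π y * h * (π y)⁻¹ ∈ π.clusterSubgroup := by
  have h' := MapClusterPt.continuousAt_comp (f := fun p : H => π y * p * (π y)⁻¹)
    (by fun_prop) hh
  refine MapClusterPt.of_comp (φ := fun p : G => y * p * y⁻¹) (p := 𝓝 1) ?_ ?_
  · simpa using (show Continuous fun p : G => y * p * y⁻¹ by fun_prop).tendsto 1
  · convert h' using 1
    ext p
    simp

/-- Conjugation by `π y` as an automorphism of the topological group `π.clusterSubgroup`. -/
def conjClusterSubgroup (y : G) : π.clusterSubgroup ≃ₜ* π.clusterSubgroup where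
  toFun k := ⟨π y * k * (π y)⁻¹, π.conj_mem_clusterSubgroup y k.2⟩
  invFun k := ⟨(π y)⁻¹ * k * π y, by simpa using π.conj_mem_clusterSubgroup y⁻¹ k.2⟩
  left_inv k := by ext; simp [mul_assoc]
  right_inv k := by ext; simp [mul_assoc]
  map_mul' k l := by ext; simp [mul_assoc]
  continuous_toFun := by fun_prop
  continuous_invFun := by fun_prop

@[simp]
theorem coe_conjClusterSubgroup (y : G) (k : π.clusterSubgroup) :
    (π.conjClusterSubgroup y k : H) = π y * k * (π y)⁻¹ := rfl

/-- `C` and `δ` witness discontinuity: for random `X` with locally constant dependence,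
some `g` arbitrarily close to `1` has `π (X g X⁻¹) ∉ C` with probability at least `δ`. -/
def ConjugateEscape {G H : Type*} [Group G] [TopologicalSpace G] [Group H]
    (π : G →* H) (C : Set H) (δ : ℝ≥0∞) (Ω : Type*) [TopologicalSpace Ω] [MeasurableSpace Ω] :
    Prop :=
  ∀ (ν : Measure Ω) [IsProbabilityMeasure ν] (X : Ω → G), IsLocallyConstant X →
    ∀ U ∈ 𝓝 (1 : G), ∃ g ∈ U, δ ≤ ν {a | π (X a * g * (X a)⁻¹) ∉ C}

variable {π} {Ω : Type*} [TopologicalSpace Ω] [MeasurableSpace Ω]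

-- `X` has finitely many values, so the corresponding conjugates of `C` have compact union. Some `π
-- g` lies outside it, and then escape is certain.
omit [IsTopologicalGroup G] in
theorem conjugateEscape_of_not_isCompact [CompactSpace Ω]
    (h : ∀ U ∈ 𝓝 (1 : G), ∀ Q : Set H, IsCompact Q → ¬ MapsTo π U Q)
    {C : Set H} (hC : IsCompact C) : π.ConjugateEscape C 1 Ω := by
  intro ν _ X hX U hU
  have hQ : IsCompact (⋃ y ∈ Set.range X, (fun c => (π y)⁻¹ * c * π y) '' C) :=
    hX.range_finite.isCompact_biUnion fun y _ => hC.image (by fun_prop)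
  have := h U hU _ hQ
  simp only [MapsTo, not_forall] at this
  obtain ⟨g, hg, hgQ⟩ := this
  refine ⟨g, hg, ?_⟩
  have : {a | π (X a * g * (X a)⁻¹) ∉ C} = univ := by
    refine eq_univ_of_forall fun a ha => hgQ ?_
    refine mem_biUnion (mem_range_self a) ⟨_, ha, ?_⟩
    simp [mul_assoc]
  rw [this, measure_univ]

/-- Conjugation by `π y` preserves the Haar probability measure, so by Fubini the right side,
averaged over `k`, equals the left side. -/
theorem exists_measure_conj_ge [BorelSpace Ω] [SecondCountableTopology Ω]
    [T2Space H] [SecondCountableTopology H]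
    [CompactSpace π.clusterSubgroup] [MeasurableSpace π.clusterSubgroup]
    [BorelSpace π.clusterSubgroup] (m : Measure π.clusterSubgroup) [m.IsHaarMeasure]
    [IsProbabilityMeasure m] {C : Set H} (hC : IsClosed C)
    (ν : Measure Ω) [IsProbabilityMeasure ν] {X : Ω → G} (hX : IsLocallyConstant X) :
    ∃ k : π.clusterSubgroup, m {k | (k : H) ∉ C} ≤ ν {a | π (X a) * k * (π (X a))⁻¹ ∉ C} := by
  have hπX : Continuous fun a => π (X a) := (hX.comp π).continuous
  let f : Ω × π.clusterSubgroup → H := fun p => π (X p.1) * p.2 * (π (X p.1))⁻¹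
  have hf : Continuous f := by
    have := hπX.comp (continuous_fst (Y := π.clusterSubgroup))
    exact (this.mul (continuous_subtype_val.comp continuous_snd)).mul this.inv
  have hS : MeasurableSet (f ⁻¹' Cᶜ) := (hC.isOpen_compl.preimage hf).measurableSet
  have h1 : ∀ a, m (Prod.mk a ⁻¹' (f ⁻¹' Cᶜ)) = m {k | (k : H) ∉ C} := by
    intro a
    have hm : m.map (π.conjClusterSubgroup (X a)) = m := by
      have := Measure.isProbabilityMeasure_map (μ := m)
        (π.conjClusterSubgroup (X a)).continuous.aemeasurable
      exact Measure.isHaarMeasure_eq_of_isProbabilityMeasure _ _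
    conv_rhs => rw [← hm]
    exact (Measure.map_apply (π.conjClusterSubgroup (X a)).continuous.measurable
      (hC.isOpen_compl.preimage continuous_subtype_val).measurableSet).symm
  have h2 : ∫⁻ k, ν ((fun a => (a, k)) ⁻¹' (f ⁻¹' Cᶜ)) ∂m = m {k | (k : H) ∉ C} := by
    rw [← Measure.prod_apply_symm hS, Measure.prod_apply hS]
    simp only [h1, lintegral_const, measure_univ, mul_one]
  obtain ⟨k, hk⟩ := exists_lintegral_le (μ := m)
    (f := fun k => ν ((fun a => (a, k)) ⁻¹' (f ⁻¹' Cᶜ))) (by rw [h2]; exact measure_ne_top _ _)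
  exact ⟨k, by rw [← h2]; exact hk⟩

theorem conjugateEscape_of_isCompact [CompactSpace Ω] [BorelSpace Ω] [SecondCountableTopology Ω]
    [T2Space H] [SecondCountableTopology H]
    [CompactSpace π.clusterSubgroup] [MeasurableSpace π.clusterSubgroup]
    [BorelSpace π.clusterSubgroup] (m : Measure π.clusterSubgroup) [m.IsHaarMeasure]
    [IsProbabilityMeasure m] {C : Set H} (hC : IsClosed C) :
    π.ConjugateEscape C (m {k | (k : H) ∉ C}) Ω := by
  intro ν _ X hX U hU
  obtain ⟨k, hk⟩ := exists_measure_conj_ge m hC ν hX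
  -- Escape is an open condition on `h` for each of the finitely many values of `X`, so `k` can be
  -- replaced by a nearby `π g`.
  have hO : ∀ᶠ h in 𝓝 (k : H), ∀ y ∈ {y ∈ Set.range X | π y * k * (π y)⁻¹ ∉ C},
      π y * h * (π y)⁻¹ ∉ C := by
    refine (eventually_all_finite (hX.range_finite.subset (sep_subset _ _))).2 fun y hy => ?_
    exact (show Continuous fun h : H => π y * h * (π y)⁻¹ by fun_prop).continuousAt.eventually_mem
      (hC.isOpen_compl.mem_nhds hy.2)
  obtain ⟨g, hg, hgU⟩ := ((mapClusterPt_iff_frequently.1 (π.mem_clusterSubgroup.1 k.2) _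
    hO).and_eventually hU).exists
  refine ⟨g, hgU, hk.trans (measure_mono fun a ha => ?_)⟩
  simpa using hg (X a) ⟨mem_range_self a, ha⟩

variable (Ω) in
theorem exists_conjugateEscape [CompactSpace Ω] [BorelSpace Ω] [SecondCountableTopology Ω]
    [T2Space H] [SecondCountableTopology H] [LocallyCompactSpace H] (hπ : ¬ Continuous π) :
    ∃ C ∈ 𝓝 (1 : H), ∃ δ ≠ 0, π.ConjugateEscape C δ Ω := by
  by_cases h : ∀ U ∈ 𝓝 (1 : G), ∀ Q : Set H, IsCompact Q → ¬ MapsTo π U Q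
  · obtain ⟨C, hC, hC1⟩ := exists_compact_mem_nhds (1 : H)
    exact ⟨C, hC1, 1, one_ne_zero, conjugateEscape_of_not_isCompact h hC⟩
  push Not at h
  obtain ⟨U, hU, Q, hQ, hUQ⟩ := h
  have hQ1 : Q ∈ map π (𝓝 1) := mem_map.2 (mem_of_superset hU hUQ)
  have hKQ : (π.clusterSubgroup : Set H) ⊆ Q := fun k hk =>
    hQ.isClosed.closure_eq ▸ (ClusterPt.mono hk (le_principal_iff.2 hQ1)).mem_closure
  have : CompactSpace π.clusterSubgroup :=
    isCompact_iff_compactSpace.1 (hQ.of_isClosed_subset π.isClosed_clusterSubgroup hKQ)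
  -- Inside the compact `Q`, a unique cluster point `1` would force convergence to `1`.
  obtain ⟨k, hk, hk1⟩ : ∃ k ∈ π.clusterSubgroup, k ≠ 1 := by
    by_contra! hK
    refine hπ (continuous_of_tendsto_nhds_one π ?_)
    exact hQ.le_nhds_of_unique_clusterPt hQ1 fun x _ hx => hK x hx
  borelize ↥π.clusterSubgroup
  let m : Measure π.clusterSubgroup := Measure.haarMeasure ⊤
  have : IsProbabilityMeasure m := ⟨by
    simpa [m] using Measure.haarMeasure_self (G := π.clusterSubgroup) (K₀ := ⊤)⟩
  obtain ⟨C, hC1, hC, hCk⟩ := exists_mem_nhds_isClosed_subset (isOpen_ne.mem_nhds hk1.symm)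
  refine ⟨C, hC1, m {k | (k : H) ∉ C}, ?_, conjugateEscape_of_isCompact m hC⟩
  refine ((hC.isOpen_compl.preimage continuous_subtype_val).measure_pos m
    ⟨⟨k, hk⟩, fun h => hCk h rfl⟩).ne'

end MonoidHom

/-! ### Measurable maps under small translations -/

/-- Points of a null measurable set are moved out of it by small translations with small
probability. -/
theorem MeasureTheory.NullMeasurableSet.tendsto_measure_add_notMem {Ω : Type*} [AddGroup Ω]
    [TopologicalSpace Ω] [IsTopologicalAddGroup Ω] [CompactSpace Ω] [MeasurableSpace Ω]
    [BorelSpace Ω] {ν : Measure Ω} [IsFiniteMeasure ν] [ν.Regular] [ν.IsAddLeftInvariant]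
    {A : Set Ω} (hA : NullMeasurableSet A ν) :
    Tendsto (fun e : Ω => ν {a ∈ A | e + a ∉ A}) (𝓝 0) (𝓝 0) := by
  refine ENNReal.nhds_zero_basis.tendsto_right_iff.2 fun ε hε => ?_
  have hε2 : ε / 2 ≠ 0 := (ENNReal.half_pos hε.ne').ne'
  obtain ⟨B, hBA, hB, hBae⟩ := hA.exists_measurable_subset_ae_eq
  obtain ⟨F, hFB, hF, hFε⟩ := hB.exists_isClosed_sdiff_lt (measure_ne_top ν B) hε2
  have hAB : ν (A \ B) = 0 := ae_le_set.1 hBae.symm.le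
  filter_upwards [eventually_nhds_zero_measure_vadd_sdiff_lt (μ := ν) hF.isCompact hF hε2]
    with e he
  have hsub : {a ∈ A | e + a ∉ A} ⊆
      A \ B ∪ (B \ F ∪ (fun a => e + a) ⁻¹' ((e +ᵥ F) \ F)) := by
    rintro a ⟨ha, hea⟩
    by_cases haB : a ∈ B
    · by_cases haF : a ∈ F
      · exact .inr (.inr ⟨vadd_mem_vadd_set haF, fun h => hea (hBA (hFB h))⟩)
      · exact .inr (.inl ⟨haB, haF⟩)
    · exact .inl ⟨ha, haB⟩
  calc ν {a ∈ A | e + a ∉ A} ≤ ν (A \ B) + (ν (B \ F) + ν ((e +ᵥ F) \ F)) := by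
        refine (measure_mono hsub).trans ((measure_union_le _ _).trans ?_)
        refine add_le_add le_rfl ((measure_union_le _ _).trans ?_)
        rw [measure_preimage_add]
    _ < ε / 2 + ε / 2 := by
        rw [hAB, zero_add]
        exact ENNReal.add_lt_add hFε he
    _ = ε := ENNReal.add_halves ε

/-- A measurable map from a compact group to a second countable group moves little, in
probability, under small translations of its argument. -/
theorem tendsto_measure_div_notMem {Ω H : Type*} [AddGroup Ω]
    [TopologicalSpace Ω] [IsTopologicalAddGroup Ω] [CompactSpace Ω] [MeasurableSpace Ω]
    [BorelSpace Ω] (ν : Measure Ω) [IsFiniteMeasure ν] [ν.Regular] [ν.IsAddLeftInvariant]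
    [Group H] [TopologicalSpace H] [IsTopologicalGroup H] [SecondCountableTopology H]
    {f : Ω → H} (hf : ∀ U, IsOpen U → NullMeasurableSet (f ⁻¹' U) ν)
    {C : Set H} (hC : C ∈ 𝓝 1) :
    Tendsto (fun e : Ω => ν {a | f (e + a) / f a ∉ C ∨ f a / f (e + a) ∉ C}) (𝓝 0) (𝓝 0) := by
  obtain ⟨W, hW, hW1, hWC⟩ : ∃ W : Set H, IsOpen W ∧ (1 : H) ∈ W ∧
      ∀ v ∈ W, ∀ w ∈ W, v / w ∈ C := by
    obtain ⟨V, hV, hVC⟩ := exists_nhds_split_inv hC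
    exact ⟨interior V, isOpen_interior, mem_interior_iff_mem_nhds.2 hV,
      fun v hv w hw => hVC v (interior_subset hv) w (interior_subset hw)⟩
  let h : ℕ → H := TopologicalSpace.denseSeq H
  -- Values of `f` on one `A k` have quotients in `C`. Finitely many `A k` cover all but measure `ε
  -- / 2`.
  let A : ℕ → Set Ω := fun k => f ⁻¹' {x | x * h k ∈ W}
  have hA : ∀ k, NullMeasurableSet (A k) ν := fun k =>
    hf _ (hW.preimage (continuous_mul_const (h k)))
  have hcov : ⋃ k, A k = univ := by
    refine eq_univ_of_forall fun a => mem_iUnion.2 ?_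
    obtain ⟨_, hk, k, rfl⟩ := (TopologicalSpace.denseRange_denseSeq H).inter_open_nonempty
      {y | f a * y ∈ W} (hW.preimage (continuous_const_mul (f a))) ⟨(f a)⁻¹, by simpa⟩
    exact ⟨k, hk⟩
  have hlim : Tendsto (fun M => ν (accumulate A M)ᶜ) atTop (𝓝 0) := by
    have := tendsto_measure_iInter_atTop (μ := ν) (s := fun M => (accumulate A M)ᶜ)
      (fun M => (NullMeasurableSet.biUnion (to_countable _) fun k _ => hA k).compl)
      (fun i j hij => compl_subset_compl.2 (monotone_accumulate hij)) ⟨0, measure_ne_top _ _⟩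
    rwa [← compl_iUnion, iUnion_accumulate, hcov, compl_univ, measure_empty] at this
  refine ENNReal.nhds_zero_basis.tendsto_right_iff.2 fun ε hε => ?_
  have hε2 : 0 < ε / 2 := ENNReal.half_pos hε.ne'
  obtain ⟨M, hM⟩ := (hlim.eventually_lt_const hε2).exists
  have hsum : Tendsto (fun e : Ω => ∑ k ∈ Finset.range (M + 1), ν {a ∈ A k | e + a ∉ A k})
      (𝓝 0) (𝓝 0) := by
    simpa using tendsto_finsetSum (Finset.range (M + 1))
      fun k _ => (hA k).tendsto_measure_add_notMem
  filter_upwards [hsum.eventually_lt_const hε2] with e he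
  have hsub : {a | f (e + a) / f a ∉ C ∨ f a / f (e + a) ∉ C} ⊆
      (accumulate A M)ᶜ ∪ ⋃ k ∈ Finset.range (M + 1), {a ∈ A k | e + a ∉ A k} := by
    intro a ha
    by_contra hcon
    rw [mem_union, not_or, mem_compl_iff, not_not, mem_accumulate] at hcon
    obtain ⟨⟨k, hkM, hak⟩, hcon⟩ := hcon
    have hea : e + a ∈ A k := by_contra fun h =>
      hcon (mem_biUnion (Finset.mem_coe.2 (Finset.mem_range_succ_iff.2 hkM)) ⟨hak, h⟩)
    have e1 := hWC _ hak _ hea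
    have e2 := hWC _ hea _ hak
    rw [mul_div_mul_right_eq_div] at e1 e2
    exact ha.elim (· e2) (· e1)
  calc _ ≤ ν (accumulate A M)ᶜ + ∑ k ∈ Finset.range (M + 1), ν {a ∈ A k | e + a ∉ A k} :=
        (measure_mono hsub).trans ((measure_union_le _ _).trans
          (add_le_add le_rfl (measure_biUnion_finset_le _ _)))
    _ < ε / 2 + ε / 2 := ENNReal.add_lt_add hM he
    _ = ε := ENNReal.add_halves ε

/-! ### Random products over the Cantor group -/

section partialProd

variable {G : Type*} [Group G]

/-- The product of the first `n` terms of the sequence `g` over the support of `a`. -/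
def partialProd (g : ℕ → G) : ℕ → (ℕ → ZMod 2) → G
  | 0 => fun _ => 1
  | n + 1 => fun a => partialProd g n a * if a n = 0 then 1 else g n

theorem partialProd_succ (g : ℕ → G) (n : ℕ) (a : ℕ → ZMod 2) :
    partialProd g (n + 1) a = partialProd g n a * if a n = 0 then 1 else g n := rfl

theorem isLocallyConstant_partialProd (g : ℕ → G) (n : ℕ) :
    IsLocallyConstant (partialProd g n) := by
  induction n with
  | zero => exact IsLocallyConstant.const 1
  | succ n ih =>
    exact ih.mul <| (IsLocallyConstant.of_discrete
      fun z : ZMod 2 => if z = 0 then 1 else g n).comp_continuous (continuous_apply n)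

/-- The `n`-th product involves only terms before `n`, so `g n` may be chosen depending on it. -/
theorem exists_seq_partialProd (R : ℕ → ((ℕ → ZMod 2) → G) → G → Prop)
    (h : ∀ n X, IsLocallyConstant X → ∃ g, R n X g) :
    ∃ g : ℕ → G, ∀ n, R n (partialProd g n) (g n) := by
  choose! s hs using h
  let Y : ℕ → (ℕ → ZMod 2) → G := fun n => Nat.rec (fun _ => 1)
    (fun n X a => X a * if a n = 0 then 1 else s n X) n
  have hY : ∀ n, Y n = partialProd (fun n => s n (Y n)) n := by
    intro n
    induction n with
    | zero => rfl
    | succ n ih =>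
      funext a
      rw [partialProd_succ, ← ih]
  refine ⟨fun n => s n (Y n), fun n => ?_⟩
  have := hs n _ (isLocallyConstant_partialProd (fun n => s n (Y n)) n)
  rwa [← hY] at this ⊢

theorem partialProd_single_add_of_le (g : ℕ → G) {m n : ℕ} (hmn : m ≤ n) (a : ℕ → ZMod 2) :
    partialProd g m (Pi.single n 1 + a) = partialProd g m a := by
  induction m with
  | zero => rfl
  | succ m ih =>
    rw [partialProd_succ, partialProd_succ, ih (by lia), Pi.add_apply,
      Pi.single_eq_of_ne (by lia), zero_add]

/-- The factors after position `n` agree and cancel on the right. -/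
theorem partialProd_single_add_div (g : ℕ → G) {m n : ℕ} (hmn : n < m) {a : ℕ → ZMod 2}
    (ha : a n = 0) :
    partialProd g m (Pi.single n 1 + a) / partialProd g m a =
      partialProd g n a * g n * (partialProd g n a)⁻¹ := by
  induction m, hmn using Nat.le_induction with
  | base =>
    rw [partialProd_succ, partialProd_succ, partialProd_single_add_of_le g le_rfl]
    simp [ha, div_eq_mul_inv]
  | succ m hm ih =>
    have : (Pi.single n 1 + a : ℕ → ZMod 2) m = a m := by
      rw [Pi.add_apply, Pi.single_eq_of_ne (by lia), zero_add]
    rw [partialProd_succ, partialProd_succ, this, mul_div_mul_right_eq_div, ih]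

variable [TopologicalSpace G] [IsTopologicalGroup G] [T2Space G]

/-- The two cases are bit `n` switched on and switched off. -/
theorem div_eq_or_of_tendsto_partialProd {g : ℕ → G} {φ : (ℕ → ZMod 2) → G}
    (hφ : ∀ a, Tendsto (fun m => partialProd g m a) atTop (𝓝 (φ a))) (n : ℕ) (a : ℕ → ZMod 2) :
    φ (Pi.single n 1 + a) / φ a = partialProd g n a * g n * (partialProd g n a)⁻¹ ∨
      φ a / φ (Pi.single n 1 + a) = partialProd g n a * g n * (partialProd g n a)⁻¹ := by
  have key : ∀ b : ℕ → ZMod 2, b n = 0 →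
      φ (Pi.single n 1 + b) / φ b = partialProd g n b * g n * (partialProd g n b)⁻¹ := by
    intro b hb
    refine tendsto_nhds_unique ((hφ _).div' (hφ b)) (tendsto_const_nhds.congr' ?_)
    filter_upwards [eventually_gt_atTop n] with m hm
    exact (partialProd_single_add_div g hm hb).symm
  by_cases ha : a n = 0
  · exact .inl (key a ha)
  · right
    have h1 : a n = 1 := Fin.eq_one_of_ne_zero _ ha
    have h2 : (Pi.single n 1 + (Pi.single n 1 + a) : ℕ → ZMod 2) = a := by
      rw [← add_assoc, ← Pi.single_add, CharTwo.add_self_eq_zero, Pi.single_zero, zero_add]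
    have := key (Pi.single n 1 + a) (by
      rw [Pi.add_apply, Pi.single_eq_same, h1, CharTwo.add_self_eq_zero])
    rwa [h2, partialProd_single_add_of_le g le_rfl] at this

end partialProd

theorem tendsto_pi_single_atTop {M : Type*} [Zero M] [TopologicalSpace M] (x : M) :
    Tendsto (fun n => (Pi.single n x : ℕ → M)) atTop (𝓝 0) := by
  refine tendsto_pi_nhds.2 fun i => tendsto_const_nhds.congr' ?_
  filter_upwards [eventually_gt_atTop i] with n hn
  rw [Pi.single_eq_of_ne hn.ne]
  rfl

theorem UniversallyMeasurableMap.nullMeasurableSet_preimage_comp {X Y Ω : Type*}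
    [MeasurableSpace X] [TopologicalSpace Y] [MeasurableSpace Ω] {f : X → Y}
    (hf : UniversallyMeasurableMap f) (ν : Measure Ω) [IsProbabilityMeasure ν] {φ : Ω → X}
    (hφ : Measurable φ) {U : Set Y} (hU : IsOpen U) : NullMeasurableSet (f ∘ φ ⁻¹' U) ν :=
  (hf U hU (ν.map φ) (Measure.isProbabilityMeasure_map hφ.aemeasurable)).preimage
    ⟨hφ, .rfl⟩

/-! ### Automatic continuity -/

theorem UniversallyMeasurableMap.continuous_of_t2Space
    {G : Type*} [Group G] [TopologicalSpace G] [IsTopologicalGroup G] [PolishSpace G]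
    [MeasurableSpace G] [BorelSpace G]
    {H : Type*} [Group H] [TopologicalSpace H] [IsTopologicalGroup H]
    [SecondCountableTopology H] [LocallyCompactSpace H] [T2Space H]
    {π : G →* H} (hπ : UniversallyMeasurableMap π) : Continuous π := by
  by_contra hcont
  let ν : Measure (ℕ → ZMod 2) := Measure.addHaarMeasure ⊤
  have : IsProbabilityMeasure ν := ⟨by
    simpa [ν] using Measure.addHaarMeasure_self (G := ℕ → ZMod 2) (K₀ := ⊤)⟩
  obtain ⟨C, hC, δ, hδ, hesc⟩ := MonoidHom.exists_conjugateEscape (ℕ → ZMod 2) hcont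
  let := TopologicalSpace.upgradeIsCompletelyMetrizable G
  obtain ⟨g, hg⟩ := exists_seq_partialProd
    (fun n X g => (∀ a, dist (X a) (X a * g) ≤ 1 * (1 / 2) ^ n) ∧
      δ ≤ ν {a | π (X a * g * (X a)⁻¹) ∉ C}) fun n X hX => by
    -- The metric need not be left invariant, so smallness is imposed at each of the finitely many
    -- values of `X`.
    have hU : ∀ᶠ g in 𝓝 (1 : G), ∀ y ∈ range X, dist y (y * g) < 1 * (1 / 2) ^ n := by
      refine (eventually_all_finite hX.range_finite).2 fun y _ => ?_
      have : Tendsto (fun g => dist y (y * g)) (𝓝 1) (𝓝 0) := by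
        simpa using (show Continuous fun g => dist y (y * g) by fun_prop).tendsto 1
      exact this.eventually_lt_const (by positivity)
    obtain ⟨g, hgU, hg⟩ := hesc ν X hX _ hU
    exact ⟨g, fun a => (hgU _ (mem_range_self a)).le, hg⟩
  have hlim : ∀ a, ∃ x, Tendsto (fun m => partialProd g m a) atTop (𝓝 x) := fun a => by
    refine cauchySeq_tendsto_of_complete
      (cauchySeq_of_le_geometric (1 / 2) 1 (by norm_num) fun n => ?_)
    rw [partialProd_succ]
    split_ifs
    · rw [mul_one, dist_self]
      positivity
    · exact (hg n).1 a
  choose φ hφ using hlim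
  have hφm : Measurable φ := measurable_of_tendsto_metrizable
    (fun n => (isLocallyConstant_partialProd g n).continuous.measurable) (tendsto_pi_nhds.2 hφ)
  have hzero := (tendsto_measure_div_notMem ν
    (fun U hU => hπ.nullMeasurableSet_preimage_comp ν hφm hU) hC).comp
    (tendsto_pi_single_atTop (1 : ZMod 2))
  refine hδ (le_antisymm (ge_of_tendsto' hzero fun n => (hg n).2.trans (measure_mono ?_)) bot_le)
  intro a ha
  rcases div_eq_or_of_tendsto_partialProd hφ n a with h | h
  · left
    rwa [Function.comp, Function.comp, ← map_div, h]
  · right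
    rwa [Function.comp, Function.comp, ← map_div, h]

theorem theorem2
    {G : Type*} [Group G] [TopologicalSpace G] [IsTopologicalGroup G] [PolishSpace G]
    [MeasurableSpace G] [BorelSpace G]
    {H : Type*} [Group H] [TopologicalSpace H] [IsTopologicalGroup H]
    [SecondCountableTopology H] [LocallyCompactSpace H]
    (π : G →* H) (hπ : UniversallyMeasurableMap π) :
    Continuous π := by
  -- The topology of `H` is induced from its Hausdorff quotient, so continuity can be tested there.
  have hmk := SeparationQuotient.isOpenQuotientMap_mk (X := H)
  have := hmk.locallyCompactSpace
  have := hmk.isQuotientMap.secondCountableTopology hmk.isOpenMap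
  have hq : UniversallyMeasurableMap (SeparationQuotient.mkMonoidHom.comp π) := fun U hU =>
    hπ _ (hU.preimage SeparationQuotient.continuous_mk)
  exact SeparationQuotient.isInducing_mk.continuous_iff.2 hq.continuous_of_t2Space
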